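/- Let $N\ge 1$, $1<p<\infty$, and let $\Omega\subset\mathbb R^N$ be a nonempty bounded open set (no regularity of $\partial\Omega$ is assumed). Let $a\colon\Omega\times\mathbb R^N\to\mathbb R^N$ be such that $a(\cdot,\xi)$ is measurable for every $\xi$, and for a.e. $x\in\Omega$ the map $a(x,\cdot)$ is continuous and, for all $\xi,\eta\in\mathbb R^N$, $t>0$, with constants $0<\alpha$, $\beta$, $c$ independent of $x,\xi,\eta$: - $0\le (a(x,\xi)-a(x,\eta))\cdot(\xi-\eta)$; - $\alpha|\xi|^p\le a(x,\xi)\cdot\xi$ and $|a(x,\xi)|\le\beta|\xi|^{p-1}$; - $a(x,t\xi)=t^{p-1}a(x,\xi)$ and $a(x,-\xi)=-a(x,\xi)$; - $|a(x,\xi)-a(x,\eta)|\le c\,\Psi(x,\xi,\eta)^{(p-1-\delta)/p}\,\big((a(x,\xi)-a(x,\eta))\cdot(\xi-\eta)\big)^{\delta/p}$; - $\sum_{i=1}^{m}a(x,\xi_i)\cdot(\xi_{i+1}-\xi_i)\le 0$ for all $m\ge1$ and $\xi_1,\dots,\xi_{m+1}\in\mathbb R^N$ with $\xi_{m+1}=\xi_1$;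 - $\alpha|\xi-\eta|^{\gamma}\,\Psi(x,\xi,\eta)^{1-\gamma/p}\le (a(x,\xi)-a(x,\eta))\cdot(\xi-\eta)$ (the left-hand side being read as $0$ when $\xi=\eta=0$), where $\Psi(x,\xi,\eta)=a(x,\xi)\cdot\xi+a(x,\eta)\cdot\eta$, $\delta=\min\{p/2,p-1\}$, $\gamma=\max\{2,p\}$. Let $Q=(0,1)^N$ be the unit cube, let $\rho\in L^\infty(\mathbb R^N)$ be $Q$-periodic with $0<\rho^-\le\rho\le\rho^+<\infty$ a.e., and put $\bar\rho=\int_Q\rho\,dx$ and $\rho_\varepsilon(x)=\rho(x/\varepsilon)$ for $\varepsilon>0$. For a weight $w$ and $k\ge 1$, the $k$-th variational eigenvalue of $$-\operatorname{div}(a(x,\nabla u))=\lambda\, w\,|u|^{p-2}u\ \text{ in }\Omega,\qquad u=0\ \text{ on }\partial\Omega,$$ is $$\inf_{C\in\Gamma_k}\ \sup_{v\in C}\ \frac{\int_\Omega a(x,\nabla v)\cdot\nabla v\,dx}{\int_\Omega w\,|v|^p\,dx},$$ where $\Gamma_k$ is the family of compact sets $C\subset W^{1,p}_0(\Omega)\setminus\{0\}$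 with $C=-C$ and Krasnoselskii genus at least $k$ (the genus of $C$ is the least $n$ for which there is an odd continuous map $C\to\mathbb R^n\setminus\{0\}$, and $\infty$ if there is none). Let $\lambda_k^\varepsilon$ and $\lambda_k$ be the $k$-th variational eigenvalues for $w=\rho_\varepsilon$ and $w=\bar\rho$ respectively, and let $c_1$ be the optimal constant in the Poincaré inequality $\|u-\int_Q u\|_{L^1(Q)}\le c_1\|\nabla u\|_{L^1(Q)}$, $u\in W^{1,1}(Q)$. Then, for every $\varepsilon>0$ and every $k\ge1$, $$|\lambda_k^\varepsilon-\lambda_k|\le c_1\,p\,\|\rho-\bar\rho\|_{L^\infty(\mathbb R^N)}\Big(\frac{\rho^+}{\alpha}\Big)^{1/p}\frac1{\rho^-}\,\varepsilon\,\max\{\lambda_k,\lambda_k^\varepsilon\}^{1+\frac1p}.$$ -/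

import Mathlib

open MeasureTheory Set
open scoped ContDiff ENNReal

noncomputable section

/-- The open unit cube `(0,1)^N` in `ℝ^N`. -/
def unitCube (N : ℕ) : Set (EuclideanSpace ℝ (Fin N)) :=
  {x | ∀ i, x i ∈ Ioo (0 : ℝ) 1}

/-- `φ` belongs to `C_c^∞(U)`. -/
def IsTestFunction {N : ℕ} (U : Set (EuclideanSpace ℝ (Fin N)))
    (φ : EuclideanSpace ℝ (Fin N) → ℝ) : Prop :=
  ContDiff ℝ ∞ φ ∧ HasCompactSupport φ ∧ tsupport φ ⊆ U

/-- `u ∈ W^{1,1}(U)` with weak gradient `g`. -/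
def IsW11 {N : ℕ} (U : Set (EuclideanSpace ℝ (Fin N)))
    (u : EuclideanSpace ℝ (Fin N) → ℝ)
    (g : EuclideanSpace ℝ (Fin N) → EuclideanSpace ℝ (Fin N)) : Prop :=
  IntegrableOn u U ∧ IntegrableOn g U ∧
    ∀ φ, IsTestFunction U φ →
      ∫ x in U, u x • gradient φ x = -∫ x in U, φ x • g x

/-- The optimal constant `c₁` in Poincaré's inequality
`‖u - (u)_Q‖_{L¹(Q)} ≤ c₁ ‖∇u‖_{L¹(Q)}`, `u ∈ W^{1,1}(Q)`, on the unit cube `Q ⊂ ℝ^N`. -/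
def poincareConstant (N : ℕ) : ℝ :=
  sInf {c : ℝ | 0 ≤ c ∧ ∀ u g, IsW11 (unitCube N) u g →
    ∫ x in unitCube N, |u x - ⨍ y in unitCube N, u y| ≤ c * ∫ x in unitCube N, ‖g x‖}

/-- Conditions (H0)-(H8) on the nonlinearity `a : Ω × ℝ^N → ℝ^N`, for almost every `x ∈ Ω` and all
`ξ ∈ ℝ^N`, with `Ψ(x, ξ, η) = a(x, ξ)·ξ + a(x, η)·η`, `δ = min {p/2, p-1}`, `γ = max {2, p}`. -/
structure IsAdmissibleOperator {N : ℕ} (p : ℝ) (Ω : Set (EuclideanSpace ℝ (Fin N))) (α β : ℝ)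
    (a : EuclideanSpace ℝ (Fin N) → EuclideanSpace ℝ (Fin N) → EuclideanSpace ℝ (Fin N)) :
    Prop where
  measurable : ∀ ξ, AEMeasurable (fun x => a x ξ) (volume.restrict Ω)
  continuous : ∀ᵐ x ∂(volume.restrict Ω), Continuous (a x)
  monotone : ∀ᵐ x ∂(volume.restrict Ω), ∀ ξ η, 0 ≤ inner ℝ (a x ξ - a x η) (ξ - η)
  coercive : ∀ᵐ x ∂(volume.restrict Ω), ∀ ξ, α * ‖ξ‖ ^ p ≤ inner ℝ (a x ξ) ξ
  bounded : ∀ᵐ x ∂(volume.restrict Ω), ∀ ξ, ‖a x ξ‖ ≤ β * ‖ξ‖ ^ (p - 1)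
  homogeneous : ∀ᵐ x ∂(volume.restrict Ω), ∀ ξ, ∀ t : ℝ, 0 < t →
    a x (t • ξ) = t ^ (p - 1) • a x ξ
  odd : ∀ᵐ x ∂(volume.restrict Ω), ∀ ξ, a x (-ξ) = -a x ξ
  equicontinuous : ∃ c : ℝ, ∀ᵐ x ∂(volume.restrict Ω), ∀ ξ η,
    ‖a x ξ - a x η‖ ≤
      c * (inner ℝ (a x ξ) ξ + inner ℝ (a x η) η) ^ ((p - 1 - min (p / 2) (p - 1)) / p) *
        (inner ℝ (a x ξ - a x η) (ξ - η)) ^ (min (p / 2) (p - 1) / p)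
  cyclic : ∀ᵐ x ∂(volume.restrict Ω), ∀ (m : ℕ) (ξ : ℕ → EuclideanSpace ℝ (Fin N)), ξ m = ξ 0 →
    ∑ i ∈ Finset.range m, inner ℝ (a x (ξ i)) (ξ (i + 1) - ξ i) ≤ 0
  strict : ∀ᵐ x ∂(volume.restrict Ω), ∀ ξ η,
    α * ‖ξ - η‖ ^ (max 2 p) *
        (inner ℝ (a x ξ) ξ + inner ℝ (a x η) η) ^ (1 - max 2 p / p) ≤
      inner ℝ (a x ξ - a x η) (ξ - η)

instance factOneLeOfReal {p : ℝ} [hp : Fact (1 < p)] : Fact (1 ≤ ENNReal.ofReal p) :=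
  ⟨ENNReal.one_le_ofReal.2 hp.out.le⟩

/-- Pairs consisting of a function in `L^p(Ω)` and a vector field in `L^p(Ω)^N`. A Sobolev function
`u` is represented by the pair `(u, ∇u)`; the norm of the pair is equivalent to the usual norm
of `W^{1,p}(Ω)`. -/
abbrev SobolevPair {N : ℕ} (p : ℝ) (Ω : Set (EuclideanSpace ℝ (Fin N))) : Type :=
  Lp ℝ (ENNReal.ofReal p) (volume.restrict Ω) ×
    Lp (EuclideanSpace ℝ (Fin N)) (ENNReal.ofReal p) (volume.restrict Ω)

/-- `W_0^{1,p}(Ω)`: the closure of `C_c^∞(Ω)` in the norm of `W^{1,p}(Ω)`, each `u` being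
represented by `(u, ∇u)`. -/
def sobolevZero {N : ℕ} (p : ℝ) [Fact (1 < p)] (Ω : Set (EuclideanSpace ℝ (Fin N))) :
    Set (SobolevPair p Ω) :=
  closure {v | ∃ φ, IsTestFunction Ω φ ∧
    v.1 =ᵐ[volume.restrict Ω] φ ∧ v.2 =ᵐ[volume.restrict Ω] gradient φ}

/-- The Krasnoselskii genus of a symmetric set `A` (with `0 ∉ A`): the least `n` for which there is
an odd continuous map `A → ℝ^n ∖ {0}`, and `⊤` if there is none. -/
def krasnoselskiiGenus {X : Type*} [TopologicalSpace X] [Neg X] (A : Set X) : ℕ∞ :=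
  ⨅ (n : ℕ) (_ : ∃ f : X → EuclideanSpace ℝ (Fin n), ContinuousOn f A ∧
    ∀ x ∈ A, f x ≠ 0 ∧ f (-x) = -f x), (n : ℕ∞)

/-- `Γ_k`: the compact symmetric subsets of `W_0^{1,p}(Ω) ∖ {0}` of genus at least `k`. -/
def genusClass {N : ℕ} (p : ℝ) [Fact (1 < p)] (Ω : Set (EuclideanSpace ℝ (Fin N))) (k : ℕ) :
    Set (Set (SobolevPair p Ω)) :=
  {C | C ⊆ sobolevZero p Ω ∧ 0 ∉ C ∧ IsCompact C ∧ (∀ v, v ∈ C ↔ -v ∈ C) ∧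
    (k : ℕ∞) ≤ krasnoselskiiGenus C}

/-- The quotient `∫_Ω a(x, ∇v)·∇v / ∫_Ω w |v|^p`. -/
def rayleighQuotient {N : ℕ} (p : ℝ) (Ω : Set (EuclideanSpace ℝ (Fin N)))
    (a : EuclideanSpace ℝ (Fin N) → EuclideanSpace ℝ (Fin N) → EuclideanSpace ℝ (Fin N))
    (w : EuclideanSpace ℝ (Fin N) → ℝ) (v : SobolevPair p Ω) : ℝ :=
  (∫ x in Ω, inner ℝ (a x (v.2 x)) (v.2 x)) / ∫ x in Ω, w x * |v.1 x| ^ p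

/-- The `k`-th variational eigenvalue `inf_{C ∈ Γ_k} sup_{v ∈ C} ∫ a(x, ∇v)·∇v / ∫ w |v|^p` of
`-div (a(x, ∇u)) = λ w |u|^{p-2} u` in `Ω`, `u = 0` on `∂Ω`. -/
def variationalEigenvalue {N : ℕ} (p : ℝ) [Fact (1 < p)] (Ω : Set (EuclideanSpace ℝ (Fin N)))
    (a : EuclideanSpace ℝ (Fin N) → EuclideanSpace ℝ (Fin N) → EuclideanSpace ℝ (Fin N))
    (w : EuclideanSpace ℝ (Fin N) → ℝ) (k : ℕ) : ℝ :=
  sInf ((fun C => sSup (rayleighQuotient p Ω a w '' C)) '' genusClass p Ω k)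

end

/-! Both eigenvalues are min-max values over the same family of sets, so it is enough to compare the
two Rayleigh quotients at a single `v` in `W_0^{1,p}(Ω)`. Their numerators agree, and the
denominators differ by `∫ (ρ_ε - ρ̄)|v|^p`.

For a test function `φ`, extended by zero, this difference is rescaled to period one and cut into
lattice cells. On each cell `ρ - ρ̄` has zero mean, so the mean of the other factor can be
subtracted and Poincaré's inequality in `L¹` applied (`abs_integral_periodic_mul_le`). Scaling back
gives the bound `c₁ p ‖ρ - ρ̄‖_∞ ε ∫ |φ|^(p-1) |∇φ|` (`abs_integral_oscillating_mul_rpow_le`).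
Working on whole space with compactly supported functions is what makes the boundary of `Ω`
irrelevant. Density and Hölder carry the bound to `W_0^{1,p}(Ω)`.

Coercivity controls `‖∇v‖/‖v‖` by the quotient to the power `1/p`, whence `R₂ ≤ f(R₁)` with `f(s) =
s + K s^(1+1/p)` (`quotient_le_add_rpow`), and symmetrically. As `f` is increasing and continuous,
the inequality survives the supremum and the infimum (`sInf_sSup_le_of_le`).

Since `c₁` is an infimum of admissible constants, some admissible constant has to be produced first
(`exists_poincare_unitCube`). -/

/-! ### Poincaré's inequality on the unit cube, by translations -/

theorem IsTestFunction.comp_sub {N : ℕ} {U V : Set (EuclideanSpace ℝ (Fin N))}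
    {φ : EuclideanSpace ℝ (Fin N) → ℝ} (hφ : IsTestFunction V φ) (a : EuclideanSpace ℝ (Fin N))
    (hVU : ∀ x ∈ V, x + a ∈ U) : IsTestFunction U (fun x => φ (x - a)) := by
  refine ⟨hφ.1.comp (contDiff_id.sub contDiff_const),
    hφ.2.1.comp_homeomorph (Homeomorph.subRight a), ?_⟩
  intro x hx
  have h := tsupport_comp_subset_preimage φ (Homeomorph.subRight a).continuous hx
  simpa using hVU _ (hφ.2.2 h)

theorem gradient_comp_sub {N : ℕ} (φ : EuclideanSpace ℝ (Fin N) → ℝ)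
    (a x : EuclideanSpace ℝ (Fin N)) :
    gradient (fun x => φ (x - a)) x = gradient φ (x - a) := by
  simp only [gradient, fderiv_comp_sub]

theorem ContDiff.continuous_gradient {N : ℕ} {φ : EuclideanSpace ℝ (Fin N) → ℝ}
    (hφ : ContDiff ℝ 1 φ) : Continuous (gradient φ) :=
  (LinearIsometryEquiv.continuous _).comp (hφ.continuous_fderiv one_ne_zero)

theorem norm_gradient {N : ℕ} (φ : EuclideanSpace ℝ (Fin N) → ℝ)
    (x : EuclideanSpace ℝ (Fin N)) : ‖gradient φ x‖ = ‖fderiv ℝ φ x‖ := by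
  simp [gradient]

theorem HasCompactSupport.gradient {N : ℕ} {φ : EuclideanSpace ℝ (Fin N) → ℝ}
    (hφ : HasCompactSupport φ) : HasCompactSupport (gradient φ) :=
  (hφ.fderiv (𝕜 := ℝ)).comp_left (g := (InnerProductSpace.toDual ℝ _).symm) (map_zero _)

theorem sub_eq_integral_inner_gradient {N : ℕ} {φ : EuclideanSpace ℝ (Fin N) → ℝ}
    (hφ : ContDiff ℝ 1 φ) (x h : EuclideanSpace ℝ (Fin N)) :
    φ (x - h) - φ x = ∫ t in Ioc (0 : ℝ) 1, -inner ℝ (gradient φ (x - t • h)) h := by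
  have hd : ∀ t : ℝ, HasDerivAt (fun t : ℝ => φ (x - t • h))
      (-inner ℝ (gradient φ (x - t • h)) h) t := by
    intro t
    have h1 : HasDerivAt (fun t : ℝ => x - t • h) (-h) t := by
      simpa using ((hasDerivAt_id t).smul_const h).const_sub x
    have h2 := ((hφ.differentiable one_ne_zero) (x - t • h)).hasFDerivAt.comp_hasDerivAt t h1
    rw [map_neg, ← inner_gradient_left] at h2
    exact h2
  have hc : Continuous fun t : ℝ => -inner ℝ (gradient φ (x - t • h)) h := by
    have := hφ.continuous_gradient
    fun_prop
  rw [← intervalIntegral.integral_of_le zero_le_one,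
    intervalIntegral.integral_eq_sub_of_hasDerivAt (fun t _ => hd t) (hc.intervalIntegrable _ _)]
  simp

theorem measurable_translate_uncurry {N : ℕ} {G : Type*} [MeasurableSpace G]
    {g : EuclideanSpace ℝ (Fin N) → G} (hg : Measurable g) (h : EuclideanSpace ℝ (Fin N)) :
    Measurable fun q : EuclideanSpace ℝ (Fin N) × ℝ => g (q.1 + q.2 • h) :=
  hg.comp (by fun_prop : Continuous fun q : EuclideanSpace ℝ (Fin N) × ℝ => q.1 + q.2 • h).measurable

theorem integrable_translate_prod {N : ℕ}
    {g : EuclideanSpace ℝ (Fin N) → EuclideanSpace ℝ (Fin N)} (hg : Measurable g)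
    (hgi : Integrable g) (h : EuclideanSpace ℝ (Fin N)) :
    Integrable (fun q : EuclideanSpace ℝ (Fin N) × ℝ => g (q.1 + q.2 • h))
      (volume.prod (volume.restrict (Ioc 0 1))) := by
  rw [integrable_prod_iff' (measurable_translate_uncurry hg h).aestronglyMeasurable]
  refine ⟨.of_forall fun t => hgi.comp_add_right (t • h), ?_⟩
  have : ∀ t : ℝ, ∫ x, ‖g (x + t • h)‖ = ∫ x, ‖g x‖ := fun t =>
    integral_add_right_eq_self (fun x => ‖g x‖) (t • h)
  simp only [this]
  exact integrable_const _

/-- A function with integrable weak gradient on a convex open set satisfies the fundamental theorem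
of calculus along almost every translate of a segment. -/
theorem ae_translate_sub_eq {N : ℕ} {U : Set (EuclideanSpace ℝ (Fin N))} (hU : IsOpen U)
    (hUc : Convex ℝ U) {u : EuclideanSpace ℝ (Fin N) → ℝ}
    {g : EuclideanSpace ℝ (Fin N) → EuclideanSpace ℝ (Fin N)} (hui : Integrable u)
    (hg : Measurable g) (hgi : Integrable g)
    (hw : ∀ φ, IsTestFunction U φ → ∫ x, u x • gradient φ x = -∫ x, φ x • g x)
    (h : EuclideanSpace ℝ (Fin N)) :
    ∀ᵐ x, x ∈ U ∩ {x | x + h ∈ U} →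
      (u (x + h) - u x) - ∫ t in Ioc (0 : ℝ) 1, inner ℝ (g (x + t • h)) h = 0 := by
  have hprod := (integrable_translate_prod hg hgi h).inner_const (𝕜 := ℝ) h
  have hgt := hprod.integral_prod_left
  have hdiff : Integrable fun x => u (x + h) - u x := (hui.comp_add_right h).sub hui
  refine IsOpen.ae_eq_zero_of_integral_contDiff_smul_eq_zero
    (hU.inter (hU.preimage (by fun_prop : Continuous fun x => x + h)))
    ((hdiff.sub hgt).locallyIntegrable.locallyIntegrableOn _) ?_
  intro φ hφ hφc hφU
  have hφ1 : ContDiff ℝ 1 φ := hφ.of_le (by exact_mod_cast le_top)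
  -- Convexity enters here: if `x` and `x + h` lie in `U`, so does `x + t • h`, so every
  -- intermediate translate of `φ` is still an admissible test function.
  have htest : ∀ t ∈ Ioc (0 : ℝ) 1, IsTestFunction U fun x => φ (x - t • h) := by
    intro t ht
    refine IsTestFunction.comp_sub ⟨hφ, hφc, hφU⟩ _ fun x hx => ?_
    have := hUc hx.1 hx.2 (sub_nonneg.2 ht.2) ht.1.le (by ring)
    convert this using 1
    module
  obtain ⟨C, hC⟩ := hφc.exists_bound_of_continuous hφ.continuous
  obtain ⟨C', hC'⟩ := hφc.gradient.exists_bound_of_continuous hφ1.continuous_gradient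
  have hφi : ∀ {f : EuclideanSpace ℝ (Fin N) → ℝ}, Integrable f → Integrable fun x => φ x * f x :=
    fun hf => hf.bdd_mul hφ.continuous.aestronglyMeasurable (.of_forall hC)
  have hcont : Continuous fun q : EuclideanSpace ℝ (Fin N) × ℝ =>
      -inner ℝ (gradient φ (q.1 - q.2 • h)) h := by
    have := hφ1.continuous_gradient
    fun_prop
  have hswap1 : Integrable (fun q : EuclideanSpace ℝ (Fin N) × ℝ =>
      u q.1 * -inner ℝ (gradient φ (q.1 - q.2 • h)) h)
      (volume.prod (volume.restrict (Ioc 0 1))) := by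
    refine (hui.comp_fst _).mul_bdd (c := C' * ‖h‖) hcont.aestronglyMeasurable (.of_forall fun q => ?_)
    rw [norm_neg]
    exact (norm_inner_le_norm _ _).trans (by gcongr; exact hC' _)
  have hswap2 : Integrable (fun q : EuclideanSpace ℝ (Fin N) × ℝ =>
      φ q.1 * inner ℝ (g (q.1 + q.2 • h)) h) (volume.prod (volume.restrict (Ioc 0 1))) :=
    hprod.bdd_mul (hφ.continuous.comp continuous_fst).aestronglyMeasurable
      (.of_forall fun q => hC q.1)
  -- For fixed `t`, this is the definition of the weak gradient tested with the translate of `φ`,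
  -- followed by the change of variables `x ↦ x + t • h`.
  have hslice : ∀ t ∈ Ioc (0 : ℝ) 1, ∫ x, u x * -inner ℝ (gradient φ (x - t • h)) h =
      ∫ x, φ x * inner ℝ (g (x + t • h)) h := by
    intro t ht
    have hcg : Continuous fun x => gradient φ (x - t • h) := by
      have := hφ1.continuous_gradient
      fun_prop
    have hcφ : Continuous fun x => φ (x - t • h) := by
      have := hφ.continuous
      fun_prop
    have h1 := congrArg (fun v => inner ℝ h v) (hw _ (htest t ht))
    simp only [gradient_comp_sub] at h1
    rw [inner_neg_right, ← integral_inner, ← integral_inner] at h1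
    · have e1 := integral_add_right_eq_self
        (fun x => φ (x - t • h) * inner ℝ (g x) h) (t • h) (μ := volume)
      simp only [add_sub_cancel_right] at e1
      rw [e1]
      simp only [real_inner_comm _ h, real_inner_smul_left] at h1
      simp only [mul_neg, integral_neg, h1, neg_neg]
    · exact hgi.bdd_smul C hcφ.aestronglyMeasurable (.of_forall fun x => hC _)
    · exact hui.smul_bdd C' hcg.aestronglyMeasurable (.of_forall fun x => hC' _)
  have hLu : ∫ x, φ x * (u (x + h) - u x) = ∫ x, u x * (φ (x - h) - φ x) := by
    have e1 := integral_add_right_eq_self (fun x => φ (x - h) * u x) h (μ := volume)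
    simp only [add_sub_cancel_right] at e1
    have hi1 := hφi (hui.comp_add_right h)
    have hi2 : Integrable fun x => u x * φ (x - h) :=
      hui.mul_bdd (c := C) (by have := hφ.continuous; fun_prop) (.of_forall fun x => hC _)
    simp only [mul_sub]
    rw [integral_sub hi1 (hφi hui), integral_sub hi2 (by simpa [mul_comm] using hφi hui), e1]
    simp only [mul_comm]
  simp only [smul_eq_mul, mul_sub _ (u _ - u _)]
  rw [integral_sub (hφi hdiff) (hφi hgt), sub_eq_zero, hLu]
  simp only [sub_eq_integral_inner_gradient hφ1 _ h, ← integral_const_mul]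
  rw [integral_integral_swap (f := fun x t => u x * -inner ℝ (gradient φ (x - t • h)) h) hswap1,
    integral_integral_swap (f := fun x t => φ x * inner ℝ (g (x + t • h)) h) hswap2]
  exact setIntegral_congr_fun measurableSet_Ioc hslice

/-- The fundamental theorem of calculus along segments is integrated in `x`; after Tonelli,
translation invariance makes the inner integral independent of `t`. -/
theorem lintegral_translate_sub_le {N : ℕ} {U : Set (EuclideanSpace ℝ (Fin N))} (hU : IsOpen U)
    (hUc : Convex ℝ U) {u : EuclideanSpace ℝ (Fin N) → ℝ}
    {g : EuclideanSpace ℝ (Fin N) → EuclideanSpace ℝ (Fin N)} (hui : Integrable u)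
    (hg : Measurable g) (hgi : Integrable g)
    (hw : ∀ φ, IsTestFunction U φ → ∫ x, u x • gradient φ x = -∫ x, φ x • g x)
    (h : EuclideanSpace ℝ (Fin N)) :
    ∫⁻ x in U ∩ {x | x + h ∈ U}, ‖u (x + h) - u x‖ₑ ≤ ‖h‖ₑ * ∫⁻ x, ‖g x‖ₑ := by
  have hm : MeasurableSet (U ∩ {x | x + h ∈ U}) :=
    (hU.inter (hU.preimage (by fun_prop : Continuous fun x => x + h))).measurableSet
  calc ∫⁻ x in U ∩ {x | x + h ∈ U}, ‖u (x + h) - u x‖ₑ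
      ≤ ∫⁻ x in U ∩ {x | x + h ∈ U}, ∫⁻ t in Ioc (0 : ℝ) 1, ‖g (x + t • h)‖ₑ * ‖h‖ₑ := by
        refine lintegral_mono_ae ?_
        refine (ae_restrict_iff' hm).2 ?_
        filter_upwards [ae_translate_sub_eq hU hUc hui hg hgi hw h] with x hx hxU
        rw [sub_eq_zero.1 (hx hxU)]
        refine (enorm_integral_le_lintegral_enorm _).trans (lintegral_mono fun t => ?_)
        simp only [enorm_eq_nnnorm]
        exact_mod_cast nnnorm_inner_le_nnnorm _ _
    _ ≤ ∫⁻ x, ∫⁻ t in Ioc (0 : ℝ) 1, ‖g (x + t • h)‖ₑ * ‖h‖ₑ := setLIntegral_le_lintegral _ _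
    _ = ∫⁻ t in Ioc (0 : ℝ) 1, ∫⁻ x, ‖g (x + t • h)‖ₑ * ‖h‖ₑ :=
        lintegral_lintegral_swap
          ((measurable_translate_uncurry hg h).enorm.mul_const _).aemeasurable
    _ = ∫⁻ t in Ioc (0 : ℝ) 1, ‖h‖ₑ * ∫⁻ x, ‖g x‖ₑ := by
        refine lintegral_congr fun t => ?_
        rw [lintegral_mul_const _ (by fun_prop), mul_comm,
          lintegral_add_right_eq_self (fun x => ‖g x‖ₑ) (t • h)]
    _ = ‖h‖ₑ * ∫⁻ x, ‖g x‖ₑ := by simp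

theorem unitCube_eq_preimage (N : ℕ) : unitCube N =
    WithLp.ofLp ⁻¹' univ.pi fun _ => Ioo (0 : ℝ) 1 := by
  ext x
  simp [unitCube]

theorem isOpen_unitCube (N : ℕ) : IsOpen (unitCube N) := by
  have : unitCube N = ⋂ i, (fun x : EuclideanSpace ℝ (Fin N) => x i) ⁻¹' Ioo (0 : ℝ) 1 := by
    ext x; simp [unitCube]
  rw [this]
  exact isOpen_iInter_of_finite fun i => isOpen_Ioo.preimage (by fun_prop)

theorem convex_unitCube (N : ℕ) : Convex ℝ (unitCube N) := by
  intro x hx y hy s t hs ht hst i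
  exact convex_Ioo (0 : ℝ) 1 (hx i) (hy i) hs ht hst

theorem volume_unitCube (N : ℕ) : volume (unitCube N) = 1 := by
  rw [unitCube_eq_preimage, (PiLp.volume_preserving_ofLp (Fin N)).measure_preimage
    (MeasurableSet.univ_pi fun _ => measurableSet_Ioo).nullMeasurableSet]
  simp [Real.volume_pi_Ioo]

theorem norm_le_of_mem_unitCube {N : ℕ} {x : EuclideanSpace ℝ (Fin N)} (hx : x ∈ unitCube N) :
    ‖x‖ ≤ N := by
  refine le_of_sq_le_sq ?_ N.cast_nonneg
  rw [EuclideanSpace.norm_sq_eq]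
  calc ∑ i, ‖x i‖ ^ 2 ≤ ∑ _i : Fin N, (1 : ℝ) := by
        refine Finset.sum_le_sum fun i _ => ?_
        rw [Real.norm_of_nonneg (hx i).1.le]
        exact pow_le_one₀ (hx i).1.le (hx i).2.le
    _ = N := by simp
    _ ≤ (N : ℝ) ^ 2 := by exact_mod_cast Nat.le_self_pow two_ne_zero N

instance isProbabilityMeasure_unitCube (N : ℕ) :
    IsProbabilityMeasure (volume.restrict (unitCube N)) :=
  ⟨by rw [Measure.restrict_apply_univ, volume_unitCube]⟩

/-- The Poincaré inequality on the unit cube, with some constant. -/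
theorem exists_poincare_unitCube (N : ℕ) : ∃ c : ℝ, 0 ≤ c ∧ ∀ u g, IsW11 (unitCube N) u g →
    ∫ x in unitCube N, |u x - ⨍ y in unitCube N, u y| ≤ c * ∫ x in unitCube N, ‖g x‖ := by
  set Q := unitCube N with hQ
  have hQm : MeasurableSet Q := (isOpen_unitCube N).measurableSet
  -- Points of the cube have norm at most `N`, so `B` contains all their differences.
  set B := Metric.closedBall (0 : EuclideanSpace ℝ (Fin N)) (2 * N)
  have hB : volume B ≠ ⊤ := measure_closedBall_lt_top.ne
  refine ⟨(ENNReal.ofReal (2 * N) * volume B).toReal, ENNReal.toReal_nonneg, ?_⟩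
  intro u₀ g₀ hw₀
  -- Measurable representatives extended by zero. The extension need not be weakly differentiable
  -- across the boundary of `Q`; only test functions supported in `Q` are used.
  set u := Q.indicator (hw₀.1.1.mk u₀) with hu
  set g := Q.indicator (hw₀.2.1.1.mk g₀) with hg
  have hum : Measurable u := (hw₀.1.1.stronglyMeasurable_mk.measurable).indicator hQm
  have hgm : Measurable g := (hw₀.2.1.1.stronglyMeasurable_mk.measurable).indicator hQm
  have hue : u₀ =ᵐ[volume.restrict Q] u :=
    hw₀.1.1.ae_eq_mk.trans (indicator_ae_eq_restrict hQm).symm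
  have hge : g₀ =ᵐ[volume.restrict Q] g :=
    hw₀.2.1.1.ae_eq_mk.trans (indicator_ae_eq_restrict hQm).symm
  have huQ : IntegrableOn u Q := hw₀.1.congr_fun_ae hue
  have hgQ : IntegrableOn g Q := hw₀.2.1.congr_fun_ae hge
  have hui : Integrable u := (integrableOn_iff_integrable_of_support_subset
    support_indicator_subset).1 huQ
  have hgi : Integrable g := (integrableOn_iff_integrable_of_support_subset
    support_indicator_subset).1 hgQ
  have hw : ∀ φ, IsTestFunction Q φ → ∫ x, u x • gradient φ x = -∫ x, φ x • g x := by
    intro φ hφ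
    rw [← setIntegral_eq_integral_of_forall_compl_eq_zero (s := Q),
      ← setIntegral_eq_integral_of_forall_compl_eq_zero (s := Q) (f := fun x => φ x • g x)]
    · rw [← integral_congr_ae (f := fun x => u₀ x • gradient φ x)
        (by filter_upwards [hue] with x hx; rw [hx]), hw₀.2.2 φ hφ]
      exact congrArg _ (integral_congr_ae (by filter_upwards [hge] with x hx; rw [hx]))
    · intro x hx
      simp [hg, hx]
    · intro x hx
      simp [hu, hx]
  -- Substituting `y = x + h` and exchanging integrals reduces the double integral to the
  -- translation estimate for each `h` in `B`.
  have hpair : ∫⁻ x in Q, ∫⁻ y in Q, ‖u y - u x‖ₑ ≤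
      ENNReal.ofReal (2 * N) * volume B * ∫⁻ x, ‖g x‖ₑ := by
    calc ∫⁻ x in Q, ∫⁻ y in Q, ‖u y - u x‖ₑ
        = ∫⁻ x, ∫⁻ h, (Q ∩ {x | x + h ∈ Q}).indicator (fun x => ‖u (x + h) - u x‖ₑ) x := by
          rw [← lintegral_indicator hQm]
          refine lintegral_congr fun x => ?_
          by_cases hx : x ∈ Q
          · rw [indicator_of_mem hx, ← lintegral_indicator hQm,
              ← lintegral_add_left_eq_self _ x]
            refine lintegral_congr fun h => ?_
            by_cases hxh : x + h ∈ Q <;> simp [hx, hxh]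
          · simp [hx]
      _ = ∫⁻ h, ∫⁻ x, (Q ∩ {x | x + h ∈ Q}).indicator (fun x => ‖u (x + h) - u x‖ₑ) x := by
          refine lintegral_lintegral_swap (Measurable.aemeasurable ?_)
          have hS : MeasurableSet {q : EuclideanSpace ℝ (Fin N) × EuclideanSpace ℝ (Fin N) |
              q.1 ∈ Q ∧ q.1 + q.2 ∈ Q} :=
            (hQm.preimage measurable_fst).inter (hQm.preimage (by fun_prop))
          have hF : Measurable fun q : EuclideanSpace ℝ (Fin N) × EuclideanSpace ℝ (Fin N) =>
              ‖u (q.1 + q.2) - u q.1‖ₑ := by fun_prop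
          exact hF.indicator hS
      _ ≤ ∫⁻ h, B.indicator (fun _ => ENNReal.ofReal (2 * N) * ∫⁻ x, ‖g x‖ₑ) h := by
          refine lintegral_mono fun h => ?_
          have hm : MeasurableSet (Q ∩ {x | x + h ∈ Q}) :=
            hQm.inter (hQm.preimage (by fun_prop : Measurable fun x => x + h))
          rw [lintegral_indicator hm]
          by_cases hh : h ∈ B
          · rw [indicator_of_mem hh]
            refine (lintegral_translate_sub_le (isOpen_unitCube N) (convex_unitCube N) hui hgm hgi
              hw h).trans ?_
            gcongr
            rw [← ofReal_norm]
            exact ENNReal.ofReal_le_ofReal (by simpa [B] using hh)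
          · have : Q ∩ {x | x + h ∈ Q} = ∅ := by
              ext x
              simp only [mem_inter_iff, mem_ofPred_eq, mem_empty_iff_false, iff_false, not_and]
              intro hx hxh
              refine hh ?_
              have := norm_sub_le (x + h) x
              simp only [add_sub_cancel_left] at this
              have h1 := norm_le_of_mem_unitCube hx
              have h2 := norm_le_of_mem_unitCube hxh
              simp only [B, mem_closedBall_zero_iff]
              linarith
            simp [this]
      _ = _ := by
          rw [lintegral_indicator measurableSet_closedBall, setLIntegral_const]
          ring
  have hav : ⨍ y in Q, u₀ y = ∫ y in Q, u y := by
    rw [setAverage_eq, integral_congr_ae hue]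
    simp [measureReal_def, hQ, volume_unitCube]
  rw [hav, integral_congr_ae (f := fun x => ‖g₀ x‖) (g := fun x => ‖g x‖) (by filter_upwards [hge] with x hx; rw [hx]),
    integral_congr_ae (f := fun x => |u₀ x - _|) (g := fun x => |u x - ∫ y in Q, u y|)
      (by filter_upwards [hue] with x hx; rw [hx])]
  -- As `Q` has measure one, `u x` minus the mean is the average of `u x - u y` over `y`.
  have hL : ∫⁻ x in Q, ‖u x - ∫ y in Q, u y‖ₑ ≤
      ENNReal.ofReal (2 * N) * volume B * ∫⁻ x, ‖g x‖ₑ := by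
    refine le_trans (lintegral_mono fun x => ?_) hpair
    have : u x - ∫ y in Q, u y = ∫ y in Q, (u x - u y) := by
      rw [integral_sub (integrable_const _) huQ]
      simp
    rw [this]
    refine (enorm_integral_le_lintegral_enorm _).trans (lintegral_mono fun y => ?_)
    rw [enorm_sub_rev]
  have hgQ' : ∫⁻ x, ‖g x‖ₑ = ∫⁻ x in Q, ‖g x‖ₑ := by
    rw [← lintegral_indicator hQm]
    refine lintegral_congr fun x => ?_
    by_cases hx : x ∈ Q <;> simp [hg, hx]
  have hfin : ∫⁻ x in Q, ‖g x‖ₑ ≠ ⊤ := hgQ.2.ne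
  rw [hgQ'] at hL
  have h1 := ENNReal.toReal_mono (by finiteness) hL
  rw [ENNReal.toReal_mul, ← integral_norm_eq_lintegral_enorm hgQ.1,
    ← integral_norm_eq_lintegral_enorm (by fun_prop)] at h1
  simpa only [Real.norm_eq_abs] using h1

theorem poincareConstant_nonneg (N : ℕ) : 0 ≤ poincareConstant N :=
  Real.sInf_nonneg fun _ hc => hc.1

theorem poincare_unitCube {N : ℕ} {u : EuclideanSpace ℝ (Fin N) → ℝ}
    {g : EuclideanSpace ℝ (Fin N) → EuclideanSpace ℝ (Fin N)} (h : IsW11 (unitCube N) u g) :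
    ∫ x in unitCube N, |u x - ⨍ y in unitCube N, u y| ≤
      poincareConstant N * ∫ x in unitCube N, ‖g x‖ := by
  obtain ⟨c₀, hc₀⟩ := exists_poincare_unitCube N
  have hI : 0 ≤ ∫ x in unitCube N, ‖g x‖ := integral_nonneg fun _ => norm_nonneg _
  -- When the gradient integral vanishes, any admissible constant gives the claim; otherwise divide
  -- by it and pass to the infimum.
  rcases hI.eq_or_lt with hI | hI
  · have := hc₀.2 u g h
    rw [← hI, mul_zero] at this ⊢
    exact this
  · rw [← div_le_iff₀ hI]
    exact le_csInf ⟨c₀, hc₀⟩ fun c hc => (div_le_iff₀ hI).2 (hc.2 u g h)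

/-! ### Periodic weights: lattice cells and rescaling -/

theorem isW11_of_contDiff {N : ℕ} {U : Set (EuclideanSpace ℝ (Fin N))}
    {u : EuclideanSpace ℝ (Fin N) → ℝ} (hu : ContDiff ℝ 1 u) (huc : HasCompactSupport u) :
    IsW11 U u (gradient u) := by
  have hui := hu.continuous.integrable_of_hasCompactSupport (μ := volume) huc
  have hgi := hu.continuous_gradient.integrable_of_hasCompactSupport (μ := volume) huc.gradient
  refine ⟨hui.integrableOn, hgi.integrableOn, fun φ hφ => ?_⟩
  have hφ1 : ContDiff ℝ 1 φ := hφ.1.of_le (by exact_mod_cast le_top)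
  have hφ0 : ∀ x ∉ U, φ x = 0 ∧ gradient φ x = 0 := by
    intro x hx
    have hx' : x ∉ tsupport φ := fun h => hx (hφ.2.2 h)
    refine ⟨image_eq_zero_of_notMem_tsupport hx', ?_⟩
    rw [← norm_eq_zero, norm_gradient, norm_eq_zero]
    exact image_eq_zero_of_notMem_tsupport fun h => hx' (tsupport_fderiv_subset ℝ h)
  rw [setIntegral_eq_integral_of_forall_compl_eq_zero fun x hx => by rw [(hφ0 x hx).2, smul_zero],
    setIntegral_eq_integral_of_forall_compl_eq_zero fun x hx => by rw [(hφ0 x hx).1, zero_smul]]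
  have hcg := hu.continuous_gradient
  have hcu := hu.continuous
  have hcφ := hφ1.continuous
  have hcgφ := hφ1.continuous_gradient
  have h1 : Integrable fun x => u x • gradient φ x :=
    (hcu.smul hcgφ).integrable_of_hasCompactSupport huc.smul_right
  have h2 : Integrable fun x => φ x • gradient u x :=
    (hcφ.smul hcg).integrable_of_hasCompactSupport hφ.2.1.smul_right
  have h3 : Integrable fun x => u x * φ x :=
    (hcu.mul hcφ).integrable_of_hasCompactSupport huc.mul_right
  refine ext_inner_left ℝ fun v => ?_
  rw [inner_neg_right, ← integral_inner h1, ← integral_inner h2]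
  simp only [real_inner_comm _ v, real_inner_smul_left, inner_gradient_left]
  rw [integral_mul_fderiv_eq_neg_fderiv_mul_of_integrable]
  · simp only [mul_comm]
  · refine (h2.inner_const (𝕜 := ℝ) v).congr (.of_forall fun x => ?_)
    simp only [real_inner_smul_left, inner_gradient_left, mul_comm]
  · refine (h1.inner_const (𝕜 := ℝ) v).congr (.of_forall fun x => ?_)
    simp only [real_inner_smul_left, inner_gradient_left]
  · exact h3
  · exact fun x _ => hu.differentiable one_ne_zero x
  · exact fun x _ => hφ1.differentiable one_ne_zero x

/-- The standard basis, spanning the lattice `ℤ^N`. -/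
noncomputable abbrev standardBasis (N : ℕ) : Module.Basis (Fin N) ℝ (EuclideanSpace ℝ (Fin N)) :=
  (EuclideanSpace.basisFun (Fin N) ℝ).toBasis

theorem fundamentalDomain_ae_eq_unitCube (N : ℕ) :
    unitCube N =ᵐ[volume] ZSpan.fundamentalDomain (standardBasis N) := by
  have hF : ZSpan.fundamentalDomain (standardBasis N) =
      WithLp.ofLp ⁻¹' univ.pi fun _ => Ico (0 : ℝ) 1 := by
    ext x
    simp [ZSpan.mem_fundamentalDomain]
  have hv : volume (ZSpan.fundamentalDomain (standardBasis N)) = 1 := by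
    rw [hF, (PiLp.volume_preserving_ofLp (Fin N)).measure_preimage
      (MeasurableSet.univ_pi fun _ => measurableSet_Ico).nullMeasurableSet]
    simp [Real.volume_pi_Ico]
  refine ae_eq_of_subset_of_measure_ge ?_ ?_
    (isOpen_unitCube N).measurableSet.nullMeasurableSet (by simp [hv])
  · rw [hF, unitCube_eq_preimage]
    exact preimage_mono (pi_mono fun _ _ => Ioo_subset_Ico_self)
  · rw [hv, volume_unitCube]

/-- The almost-everywhere periods form an additive subgroup, because translations preserve null
sets; it contains the basis vectors, hence the lattice. -/
theorem ae_periodic_of_mem_span {N : ℕ} {w : EuclideanSpace ℝ (Fin N) → ℝ}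
    (hw : ∀ i, ∀ᵐ x, w (x + EuclideanSpace.single i 1) = w x) {z : EuclideanSpace ℝ (Fin N)}
    (hz : z ∈ Submodule.span ℤ (range (standardBasis N))) : ∀ᵐ x, w (x + z) = w x := by
  have hshift : ∀ (a : EuclideanSpace ℝ (Fin N)) {P : EuclideanSpace ℝ (Fin N) → Prop},
      (∀ᵐ x, P x) → ∀ᵐ x, P (x + a) := fun a P h =>
    (measurePreserving_add_right volume a).quasiMeasurePreserving.ae h
  let S : AddSubgroup (EuclideanSpace ℝ (Fin N)) :=
    { carrier := {z | ∀ᵐ x, w (x + z) = w x}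
      zero_mem' := by simp
      add_mem' := by
        intro a b ha hb
        change ∀ᵐ x, w (x + (a + b)) = w x
        filter_upwards [hshift a hb, ha] with x h1 h2
        rw [← add_assoc, h1, h2]
      neg_mem' := by
        intro a ha
        change ∀ᵐ x, w (x + -a) = w x
        filter_upwards [hshift (-a) ha] with x h1
        rw [← h1, neg_add_cancel_right] }
  have : Submodule.span ℤ (range (standardBasis N)) ≤ S.toIntSubmodule := by
    rw [Submodule.span_le]
    rintro _ ⟨i, rfl⟩
    simpa [S] using hw i
  exact this hz

-- Lattice translates of the half-open cube tile space, and the open cube differs from it by a null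
-- set.
open scoped Pointwise in
theorem hasSum_integral_lattice {N : ℕ} {f : EuclideanSpace ℝ (Fin N) → ℝ} (hf : Integrable f) :
    HasSum (fun z : (Submodule.span ℤ (range (standardBasis N))).toAddSubgroup => ∫ x in unitCube N, f (x + z))
      (∫ x, f x) := by
  have : Countable (Submodule.span ℤ (range (standardBasis N))).toAddSubgroup :=
    inferInstanceAs (Countable (Submodule.span ℤ (range (standardBasis N))))
  have hF := ZSpan.isAddFundamentalDomain' (standardBasis N) volume
  have h := hasSum_integral_measure (f := f) (μ := fun z : (Submodule.span ℤ
    (range (standardBasis N))).toAddSubgroup => volume.restrict (z +ᵥ ZSpan.fundamentalDomain (standardBasis N)))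
    (by rwa [hF.sum_restrict])
  rw [hF.sum_restrict] at h
  refine (congrArg (HasSum · _) (funext fun z => ?_)).mp h
  rw [setIntegral_congr_set (fundamentalDomain_ae_eq_unitCube N) (f := fun x => f (x + z))]
  have := (measurePreserving_add_right volume (z : EuclideanSpace ℝ (Fin N))).setIntegral_image_emb
    (measurableEmbedding_addRight _) f (ZSpan.fundamentalDomain (standardBasis N))
  rw [← this]
  congr 2
  exact image_congr fun x _ => add_comm (z : EuclideanSpace ℝ (Fin N)) x

/-- Zero mean of `w` allows `u` to be replaced by `u` minus its mean, to which Poincaré's inequality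
applies. -/
theorem abs_setIntegral_unitCube_mul_le {N : ℕ} {w : EuclideanSpace ℝ (Fin N) → ℝ}
    (hwm : AEStronglyMeasurable w volume) {M : ℝ} (hwM : ∀ᵐ x, |w x| ≤ M)
    (hw0 : ∫ x in unitCube N, w x = 0) {u : EuclideanSpace ℝ (Fin N) → ℝ} (hu : ContDiff ℝ 1 u)
    (huc : HasCompactSupport u) :
    |∫ x in unitCube N, w x * u x| ≤
      M * (poincareConstant N * ∫ x in unitCube N, ‖gradient u x‖) := by
  have hM : 0 ≤ M := by
    obtain ⟨x, hx⟩ := hwM.exists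
    exact (abs_nonneg _).trans hx
  have hwM' := ae_restrict_of_ae (s := unitCube N) hwM
  have hW := isW11_of_contDiff (U := unitCube N) hu huc
  set m := ⨍ y in unitCube N, u y
  have hum : Integrable (fun x => u x - m) (volume.restrict (unitCube N)) :=
    hW.1.sub (integrable_const m)
  have hwi : IntegrableOn w (unitCube N) :=
    .of_bound (by rw [volume_unitCube]; simp) hwm.restrict M hwM'
  have h1 : ∫ x in unitCube N, w x * u x = ∫ x in unitCube N, w x * (u x - m) := by
    simp only [mul_sub]
    rw [integral_sub (hW.1.bdd_mul hwm.restrict hwM') (hwi.mul_const m), integral_mul_const,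
      hw0, zero_mul, sub_zero]
  rw [h1]
  calc |∫ x in unitCube N, w x * (u x - m)| ≤ ∫ x in unitCube N, M * |u x - m| := by
        rw [← Real.norm_eq_abs]
        refine norm_integral_le_of_norm_le (hum.abs.const_mul M) ?_
        filter_upwards [hwM'] with x hx
        rw [norm_mul]
        exact mul_le_mul_of_nonneg_right hx (abs_nonneg _)
    _ ≤ _ := by
        rw [integral_const_mul]
        exact mul_le_mul_of_nonneg_left (poincare_unitCube hW) hM

/-- A bounded periodic function with zero mean on the unit cube, paired with a `C¹` function, is
controlled by the gradient of the latter. -/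
theorem abs_integral_periodic_mul_le {N : ℕ} {w : EuclideanSpace ℝ (Fin N) → ℝ}
    (hwm : AEStronglyMeasurable w volume) {M : ℝ} (hwM : ∀ᵐ x, |w x| ≤ M)
    (hwper : ∀ i, ∀ᵐ x, w (x + EuclideanSpace.single i 1) = w x)
    (hw0 : ∫ x in unitCube N, w x = 0) {u : EuclideanSpace ℝ (Fin N) → ℝ} (hu : ContDiff ℝ 1 u)
    (huc : HasCompactSupport u) :
    |∫ x, w x * u x| ≤ M * (poincareConstant N * ∫ x, ‖gradient u x‖) := by
  have hui := hu.continuous.integrable_of_hasCompactSupport (μ := volume) huc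
  have hgi := hu.continuous_gradient.integrable_of_hasCompactSupport (μ := volume) huc.gradient
  rw [← (hasSum_integral_lattice (hui.bdd_mul hwm hwM)).tsum_eq, ← Real.norm_eq_abs]
  refine tsum_of_norm_bounded
    (((hasSum_integral_lattice hgi.norm).mul_left (poincareConstant N)).mul_left M) fun z => ?_
  have hper := ae_restrict_of_ae (s := unitCube N) (ae_periodic_of_mem_span hwper z.2)
  rw [integral_congr_ae (g := fun x => w x * u (x + z))
    (by filter_upwards [hper] with x hx; rw [hx])]
  have hgrad : ∀ x, gradient u (x + z) = gradient (fun x => u (x + z)) x := fun x => by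
    simp only [gradient, fderiv_comp_add_right]
  simp only [hgrad]
  exact abs_setIntegral_unitCube_mul_le hwm hwM hw0 (hu.comp (contDiff_id.add contDiff_const))
    (huc.comp_homeomorph (Homeomorph.addRight (z : EuclideanSpace ℝ (Fin N))))

/-- The unit-scale estimate is applied to `|φ(ε x)|^p`: the chain rule supplies the factor `p ε`. -/
theorem abs_integral_oscillating_mul_rpow_le {N : ℕ} {w : EuclideanSpace ℝ (Fin N) → ℝ}
    (hwm : AEStronglyMeasurable w volume) {M : ℝ} (hwM : ∀ᵐ x, |w x| ≤ M)
    (hwper : ∀ i, ∀ᵐ x, w (x + EuclideanSpace.single i 1) = w x)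
    (hw0 : ∫ x in unitCube N, w x = 0) {p : ℝ} (hp : 1 < p) {ε : ℝ} (hε : 0 < ε)
    {φ : EuclideanSpace ℝ (Fin N) → ℝ} (hφ : ContDiff ℝ 1 φ) (hφc : HasCompactSupport φ) :
    |∫ x, w (ε⁻¹ • x) * |φ x| ^ p| ≤
      poincareConstant N * p * M * ε * ∫ x, |φ x| ^ (p - 1) * ‖gradient φ x‖ := by
  have hM : 0 ≤ M := by
    obtain ⟨x, hx⟩ := hwM.exists
    exact (abs_nonneg _).trans hx
  have hc := poincareConstant_nonneg N
  set ψ : EuclideanSpace ℝ (Fin N) → ℝ := fun x => φ (ε • x) with hψ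
  have hψ1 : ContDiff ℝ 1 ψ := hφ.comp (contDiff_const_smul ε)
  have hψc : HasCompactSupport ψ := hφc.comp_homeomorph (Homeomorph.smulOfNeZero ε hε.ne')
  set W : EuclideanSpace ℝ (Fin N) → ℝ := fun x => ‖ψ x‖ ^ p with hWdef
  have hW1 : ContDiff ℝ 1 W := hψ1.norm_rpow hp
  have hWc : HasCompactSupport W := hψc.comp_left (g := fun t : ℝ => ‖t‖ ^ p)
    (by simp [Real.zero_rpow (zero_lt_one.trans hp).ne'])
  have hgW : ∀ x, ‖gradient W x‖ ≤ p * ε * (|φ (ε • x)| ^ (p - 1) * ‖gradient φ (ε • x)‖) := by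
    intro x
    have h1 := norm_fderiv_norm_rpow_le (hψ1.differentiable one_ne_zero) (x := x) hp
    have h2 : fderiv ℝ ψ x = ε • fderiv ℝ φ (ε • x) := fderiv_comp_smul ε
    rw [h2, norm_smul, Real.norm_of_nonneg hε.le] at h1
    rw [norm_gradient, norm_gradient]
    refine h1.trans_eq ?_
    simp only [hψ, Real.norm_eq_abs]
    ring
  have hcφ := hφ.continuous
  have hcg := hφ.continuous_gradient
  have hG : Integrable fun x => |φ x| ^ (p - 1) * ‖gradient φ x‖ := by
    refine Continuous.integrable_of_hasCompactSupport ?_ hφc.gradient.norm.mul_left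
    exact (hcφ.abs.rpow_const fun _ => .inr (by linarith)).mul hcg.norm
  have hGε := hG.comp_smul hε.ne'
  have key := abs_integral_periodic_mul_le hwm hwM hwper hw0 hW1 hWc
  have hgi := hW1.continuous_gradient.integrable_of_hasCompactSupport (μ := volume) hWc.gradient
  have h3 : ∫ x, ‖gradient W x‖ ≤
      p * ε * ∫ x, |φ (ε • x)| ^ (p - 1) * ‖gradient φ (ε • x)‖ := by
    rw [← integral_const_mul]
    exact integral_mono hgi.norm (hGε.const_mul _) hgW
  have h4 : ∫ x, w x * W x = ∫ x, w (ε⁻¹ • (ε • x)) * |φ (ε • x)| ^ p := by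
    simp only [inv_smul_smul₀ hε.ne']
    rfl
  rw [Measure.integral_comp_smul volume
    (fun x => |φ x| ^ (p - 1) * ‖gradient φ x‖) ε] at h3
  rw [h4, Measure.integral_comp_smul volume (fun x => w (ε⁻¹ • x) * |φ x| ^ p) ε, smul_eq_mul,
    abs_mul, abs_abs] at key
  -- The Jacobian of the dilation; it multiplies both sides and cancels.
  set J : ℝ := |(ε ^ Module.finrank ℝ (EuclideanSpace ℝ (Fin N)))⁻¹|
  have hJ : 0 < J := by positivity
  refine le_of_mul_le_mul_left ?_ hJ
  refine key.trans ((mul_le_mul_of_nonneg_left (mul_le_mul_of_nonneg_left h3 hc) hM).trans_eq ?_)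
  rw [smul_eq_mul]
  ring

/-! ### Weighted integrals and energies on `L^p` -/

/-- Approximate `v` by simple functions: on each of their countably many fibres the composition is
some `a · ξ`, and continuity in the second variable gives the limit. -/
theorem aemeasurable_caratheodory_comp {X E F : Type*} [MeasurableSpace X] {μ : Measure X}
    [TopologicalSpace E] [TopologicalSpace F] [MeasurableSpace F] [BorelSpace F]
    [TopologicalSpace.PseudoMetrizableSpace F] {a : X → E → F}
    (ha : ∀ ξ, AEMeasurable (fun x => a x ξ) μ) (hc : ∀ᵐ x ∂μ, Continuous (a x)) {v : X → E}
    (hv : AEStronglyMeasurable v μ) : AEMeasurable (fun x => a x (v x)) μ := by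
  obtain ⟨v', hv', hvv'⟩ := hv
  refine AEMeasurable.congr (f := fun x => a x (v' x)) ?_
    (by filter_upwards [hvv'] with x hx; rw [hx])
  refine aemeasurable_of_tendsto_metrizable_ae Filter.atTop
    (f := fun n x => a x (hv'.approx n x)) (fun n => ?_) ?_
  · set s := hv'.approx n
    have hcov : ⋃ y : s.range, s ⁻¹' {(y : E)} = univ :=
      eq_univ_of_forall fun x => mem_iUnion.2 ⟨⟨s x, s.mem_range_self x⟩, rfl⟩
    rw [← Measure.restrict_univ (μ := μ), ← hcov, aemeasurable_iUnion_iff]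
    intro y
    refine ((ha y).mono_measure Measure.restrict_le_self).congr ?_
    filter_upwards [ae_restrict_mem (s.measurableSet_fiber y)] with x hx
    rw [show s x = y from hx]
  · filter_upwards [hc] with x hx
    exact (hx.tendsto _).comp (hv'.tendsto_approx x)

theorem Lp_norm_rpow_eq_integral {X F : Type*} [MeasurableSpace X] {μ : Measure X}
    [NormedAddCommGroup F] {p : ℝ} (hp : 0 < p) (f : Lp F (ENNReal.ofReal p) μ) :
    ‖f‖ ^ p = ∫ x, ‖f x‖ ^ p ∂μ := by
  have hI : 0 ≤ ∫ x, ‖f x‖ ^ p ∂μ := integral_nonneg fun x => by positivity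
  rw [Lp.norm_def, (Lp.memLp f).eLpNorm_eq_integral_rpow_norm (by simpa using hp)
    ENNReal.ofReal_ne_top, ENNReal.toReal_ofReal hp.le, ENNReal.toReal_ofReal (by positivity),
    Real.rpow_inv_rpow hI hp.ne']

theorem integrable_norm_rpow_Lp {X F : Type*} [MeasurableSpace X] {μ : Measure X}
    [NormedAddCommGroup F] {p : ℝ} (hp : 0 < p) (f : Lp F (ENNReal.ofReal p) μ) :
    Integrable (fun x => ‖f x‖ ^ p) μ := by
  simpa [ENNReal.toReal_ofReal hp.le] using
    (Lp.memLp f).integrable_norm_rpow (by simpa using hp) ENNReal.ofReal_ne_top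

theorem integral_norm_rpow_mul_norm_le {X E F : Type*} [MeasurableSpace X] {μ : Measure X}
    [NormedAddCommGroup E] [NormedAddCommGroup F] {p : ℝ} [Fact (1 ≤ ENNReal.ofReal p)]
    (hp : 1 < p) (f : Lp E (ENNReal.ofReal p) μ) (g : Lp F (ENNReal.ofReal p) μ) :
    ∫ x, ‖f x‖ ^ (p - 1) * ‖g x‖ ∂μ ≤ ‖f‖ ^ (p - 1) * ‖g‖ := by
  have hp0 : 0 < p := zero_lt_one.trans hp
  have hp1 : 0 < p - 1 := sub_pos.2 hp
  have hconj : (p / (p - 1)).HolderConjugate p := (Real.HolderConjugate.conjExponent hp).symm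
  have hm : MemLp (fun x => ‖f x‖ ^ (p - 1)) (ENNReal.ofReal (p / (p - 1))) μ := by
    have := (Lp.memLp f).norm_rpow_div (ENNReal.ofReal (p - 1))
    rwa [ENNReal.toReal_ofReal hp1.le, ← ENNReal.ofReal_div_of_pos hp1] at this
  refine (integral_mul_le_Lp_mul_Lq_of_nonneg hconj (.of_forall fun x => by positivity)
    (.of_forall fun x => norm_nonneg _) hm (Lp.memLp g).norm).trans_eq ?_
  have h1 : ∀ x, (‖f x‖ ^ (p - 1)) ^ (p / (p - 1)) = ‖f x‖ ^ p := fun x => by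
    rw [← Real.rpow_mul (norm_nonneg _), mul_div_cancel₀ _ hp1.ne']
  simp only [h1]
  rw [← Lp_norm_rpow_eq_integral hp0, ← Lp_norm_rpow_eq_integral hp0,
    ← Real.rpow_mul (norm_nonneg _), ← Real.rpow_mul (norm_nonneg _), mul_one_div_cancel hp0.ne',
    Real.rpow_one]
  congr 2
  field_simp

/-- The integral is the `p`-th power of the norm of `w^(1/p) f`, and multiplication by the bounded
function `w^(1/p)` is a continuous linear map of `L^p`. -/
theorem continuous_integral_weight_mul_rpow {X : Type*} [MeasurableSpace X] {μ : Measure X}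
    {p : ℝ} [Fact (1 ≤ ENNReal.ofReal p)] (hp0 : 0 < p) {w : X → ℝ} (hwm : AEStronglyMeasurable w μ) {C : ℝ}
    (hw : ∀ᵐ x ∂μ, 0 ≤ w x ∧ w x ≤ C) :
    Continuous fun f : Lp ℝ (ENNReal.ofReal p) μ => ∫ x, w x * |f x| ^ p ∂μ := by
  have hW : MemLp (fun x => w x ^ (1 / p)) ⊤ μ := by
    refine memLp_top_of_bound (hwm.aemeasurable.pow_const _).aestronglyMeasurable (C ^ (1 / p)) ?_
    filter_upwards [hw] with x hx
    rw [Real.norm_of_nonneg (Real.rpow_nonneg hx.1 _)]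
    exact Real.rpow_le_rpow hx.1 hx.2 (by positivity)
  have heq : ∀ f : Lp ℝ (ENNReal.ofReal p) μ, ∫ x, w x * |f x| ^ p ∂μ =
      ‖(ContinuousLinearMap.mul ℝ ℝ).holderL μ ⊤ (ENNReal.ofReal p) (ENNReal.ofReal p)
        (hW.toLp _) f‖ ^ p := by
    intro f
    rw [Lp_norm_rpow_eq_integral hp0]
    refine integral_congr_ae ?_
    filter_upwards [(ContinuousLinearMap.mul ℝ ℝ).coeFn_holder (r := ENNReal.ofReal p)
      (hW.toLp _) f, hW.coeFn_toLp, hw] with x h1 h2 h3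
    have h1' : (ContinuousLinearMap.mul ℝ ℝ).holderL μ ⊤ (ENNReal.ofReal p) (ENNReal.ofReal p)
        (hW.toLp _) f x = w x ^ (1 / p) * f x := by
      refine h1.trans ?_
      rw [h2]
      rfl
    rw [h1', norm_mul, Real.mul_rpow (norm_nonneg _) (norm_nonneg _),
      Real.norm_of_nonneg (Real.rpow_nonneg h3.1 _), ← Real.rpow_mul h3.1,
      one_div_mul_cancel hp0.ne', Real.rpow_one, Real.norm_eq_abs]
  simp only [heq]
  exact ((ContinuousLinearMap.continuous _).norm).rpow_const fun _ => .inr hp0.le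

/-- Both sides are continuous in the pair `(v, ∇v)`, so the inequality is a closed condition; on
test functions it follows from the hypothesis and Hölder. -/
theorem abs_weight_sub_le_of_mem_sobolevZero {N : ℕ} {p : ℝ} [hp : Fact (1 < p)]
    {Ω : Set (EuclideanSpace ℝ (Fin N))} {w₁ w₂ : EuclideanSpace ℝ (Fin N) → ℝ}
    (hm₁ : AEStronglyMeasurable w₁ (volume.restrict Ω))
    (hm₂ : AEStronglyMeasurable w₂ (volume.restrict Ω)) {C K : ℝ}
    (h₁ : ∀ᵐ x ∂(volume.restrict Ω), 0 ≤ w₁ x ∧ w₁ x ≤ C)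
    (h₂ : ∀ᵐ x ∂(volume.restrict Ω), 0 ≤ w₂ x ∧ w₂ x ≤ C) (hK : 0 ≤ K)
    (hφ : ∀ φ, IsTestFunction Ω φ → |∫ x in Ω, (w₁ x - w₂ x) * |φ x| ^ p| ≤
      K * ∫ x in Ω, |φ x| ^ (p - 1) * ‖gradient φ x‖)
    {v : SobolevPair p Ω} (hv : v ∈ sobolevZero p Ω) :
    |(∫ x in Ω, w₁ x * |v.1 x| ^ p) - ∫ x in Ω, w₂ x * |v.1 x| ^ p| ≤
      K * (‖v.1‖ ^ (p - 1) * ‖v.2‖) := by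
  have hp1 : 0 < p - 1 := sub_pos.2 hp.out
  have hp0 : 0 < p := zero_lt_one.trans hp.out
  have hcl : IsClosed {v : SobolevPair p Ω |
      |(∫ x in Ω, w₁ x * |v.1 x| ^ p) - ∫ x in Ω, w₂ x * |v.1 x| ^ p| ≤
      K * (‖v.1‖ ^ (p - 1) * ‖v.2‖)} := by
    refine isClosed_le ?_ ?_
    · exact (((continuous_integral_weight_mul_rpow hp0 hm₁ h₁).comp continuous_fst).sub
        ((continuous_integral_weight_mul_rpow hp0 hm₂ h₂).comp continuous_fst)).abs
    · exact continuous_const.mul ((continuous_fst.norm.rpow_const fun _ => .inr hp1.le).mul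
        continuous_snd.norm)
  refine closure_minimal ?_ hcl hv
  rintro v ⟨φ, hφt, hv1, hv2⟩
  have hint : ∀ {w : EuclideanSpace ℝ (Fin N) → ℝ}, AEStronglyMeasurable w (volume.restrict Ω) →
      (∀ᵐ x ∂(volume.restrict Ω), 0 ≤ w x ∧ w x ≤ C) →
      Integrable (fun x => w x * |v.1 x| ^ p) (volume.restrict Ω) := by
    intro w hm hw
    refine (integrable_norm_rpow_Lp hp0 v.1).bdd_mul hm (c := C) ?_
    filter_upwards [hw] with x hx
    rw [Real.norm_of_nonneg hx.1]
    exact hx.2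
  rw [mem_ofPred_eq]
  rw [← integral_sub (hint hm₁ h₁) (hint hm₂ h₂)]
  have e1 : ∫ x in Ω, (w₁ x * |v.1 x| ^ p - w₂ x * |v.1 x| ^ p) =
      ∫ x in Ω, (w₁ x - w₂ x) * |φ x| ^ p := by
    refine integral_congr_ae ?_
    filter_upwards [hv1] with x hx
    rw [hx, sub_mul]
  have e2 : ∫ x in Ω, |φ x| ^ (p - 1) * ‖gradient φ x‖ =
      ∫ x in Ω, ‖v.1 x‖ ^ (p - 1) * ‖v.2 x‖ := by
    refine integral_congr_ae ?_
    filter_upwards [hv1, hv2] with x hx hx2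
    rw [hx, hx2, Real.norm_eq_abs]
  rw [e1]
  refine (hφ φ hφt).trans (mul_le_mul_of_nonneg_left ?_ hK)
  rw [e2]
  exact integral_norm_rpow_mul_norm_le hp.out v.1 v.2

theorem IsAdmissibleOperator.mul_norm_rpow_le_energy {N : ℕ} {p : ℝ} (hp : 1 < p)
    {Ω : Set (EuclideanSpace ℝ (Fin N))} {α β : ℝ}
    {a : EuclideanSpace ℝ (Fin N) → EuclideanSpace ℝ (Fin N) → EuclideanSpace ℝ (Fin N)}
    (ha : IsAdmissibleOperator p Ω α β a)
    (g : Lp (EuclideanSpace ℝ (Fin N)) (ENNReal.ofReal p) (volume.restrict Ω)) :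
    α * ‖g‖ ^ p ≤ ∫ x in Ω, inner ℝ (a x (g x)) (g x) := by
  have hp0 : 0 < p := zero_lt_one.trans hp
  have hgi := integrable_norm_rpow_Lp hp0 g
  have hm : AEStronglyMeasurable (fun x => a x (g x)) (volume.restrict Ω) :=
    (aemeasurable_caratheodory_comp ha.measurable ha.continuous
      (Lp.aestronglyMeasurable g)).aestronglyMeasurable
  rw [Lp_norm_rpow_eq_integral hp0, ← integral_const_mul]
  refine integral_mono_ae (hgi.const_mul α) ?_ ?_
  -- The growth bound makes the energy density integrable, which monotonicity of the Bochner
  -- integral needs.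
  · refine (hgi.const_mul β).mono' (hm.inner (Lp.aestronglyMeasurable g)) ?_
    filter_upwards [ha.bounded] with x hx
    refine (norm_inner_le_norm _ _).trans
      ((mul_le_mul_of_nonneg_right (hx _) (norm_nonneg _)).trans_eq ?_)
    rw [mul_assoc, ← Real.rpow_add_one' (norm_nonneg _) (by linarith), sub_add_cancel]
  · filter_upwards [ha.coercive] with x hx using hx _

/-! ### Comparison of quotients and of their min-max values -/

/-- With `r = A / B₁`, one has `A / B₂ = r + r (B₁ - B₂) / B₂`. The last fraction is at most `(K /
m)(G / L)`, and `A ≥ α G^p` with `B₁ ≤ M L^p` gives `(G / L)^p ≤ (M / α) r`. -/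
theorem quotient_le_add_rpow {p α A B₁ B₂ L G K m M : ℝ} (hp : 1 < p) (hα : 0 < α) (hL : 0 ≤ L)
    (hG : 0 ≤ G) (hK : 0 ≤ K) (hm : 0 < m) (hM : 0 ≤ M) (hA : α * G ^ p ≤ A)
    (h₁m : m * L ^ p ≤ B₁) (h₁M : B₁ ≤ M * L ^ p) (h₂m : m * L ^ p ≤ B₂) (h₂M : B₂ ≤ M * L ^ p)
    (hB : |B₁ - B₂| ≤ K * (L ^ (p - 1) * G)) :
    A / B₂ ≤ A / B₁ + K * (M / α) ^ (1 / p) * (1 / m) * (A / B₁) ^ (1 + 1 / p) := by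
  have hp0 : 0 < p := zero_lt_one.trans hp
  have hA0 : 0 ≤ A := (by positivity : 0 ≤ α * G ^ p).trans hA
  -- If `L = 0`, both denominators vanish and both quotients are `0` by the convention for division
  -- by zero.
  rcases hL.eq_or_lt with rfl | hL
  · rw [Real.zero_rpow hp0.ne', mul_zero] at *
    rw [le_antisymm h₁M h₁m, le_antisymm h₂M h₂m]
    simp only [div_zero, zero_add]
    positivity
  have hLp : 0 < L ^ p := by positivity
  have hB₁ : 0 < B₁ := (by positivity : 0 < m * L ^ p).trans_le h₁m
  have hB₂ : 0 < B₂ := (by positivity : 0 < m * L ^ p).trans_le h₂m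
  set r := A / B₁ with hr
  have hr0 : 0 ≤ r := by positivity
  have hratio : G / L ≤ (M / α) ^ (1 / p) * r ^ (1 / p) := by
    rw [← Real.mul_rpow (by positivity) hr0]
    rw [one_div, Real.le_rpow_inv_iff_of_pos (by positivity) (by positivity) hp0,
      Real.div_rpow hG hL.le, hr, div_mul_div_comm, div_le_div_iff₀ hLp (by positivity)]
    calc G ^ p * (α * B₁) = (α * G ^ p) * B₁ := by ring
      _ ≤ A * (M * L ^ p) := by gcongr
      _ = M * A * L ^ p := by ring
  have h2 : A / B₂ = r + r * ((B₁ - B₂) / B₂) := by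
    rw [hr]
    field_simp
    ring
  have h3 : (B₁ - B₂) / B₂ ≤ K * (1 / m) * (G / L) := by
    calc (B₁ - B₂) / B₂ ≤ K * (L ^ (p - 1) * G) / (m * L ^ p) := by
          refine (div_le_div_of_nonneg_right ((le_abs_self _).trans hB) hB₂.le).trans ?_
          exact div_le_div_of_nonneg_left (by positivity) (by positivity) h₂m
      _ = K * (1 / m) * (G / L) := by
          rw [Real.rpow_sub_one hL.ne']
          field_simp
  rw [h2, Real.rpow_add' hr0 (by positivity), Real.rpow_one]
  refine add_le_add le_rfl ?_
  calc r * ((B₁ - B₂) / B₂) ≤ r * (K * (1 / m) * ((M / α) ^ (1 / p) * r ^ (1 / p))) := by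
        refine mul_le_mul_of_nonneg_left (h3.trans ?_) hr0
        exact mul_le_mul_of_nonneg_left hratio (by positivity)
    _ = _ := by ring

/-- Monotonicity of `f` handles the supremum and continuity, along a minimizing sequence, the
infimum. Real suprema of unbounded sets are `0`, so the reverse comparison `h₂₁` is needed to make
`r₁` and `r₂` unbounded on the same sets; `f 0 ≥ 0` covers empty sets. -/
theorem sInf_sSup_le_of_le {X : Type*} {Γ : Set (Set X)} {r₁ r₂ : X → ℝ} {f : ℝ → ℝ}
    (hf : MonotoneOn f (Ici 0)) (hfc : Continuous f) (hf0 : 0 ≤ f 0)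
    (h₁ : ∀ C ∈ Γ, ∀ v ∈ C, 0 ≤ r₁ v) (h₂ : ∀ C ∈ Γ, ∀ v ∈ C, 0 ≤ r₂ v)
    (h₁₂ : ∀ C ∈ Γ, ∀ v ∈ C, r₂ v ≤ f (r₁ v)) (h₂₁ : ∀ C ∈ Γ, ∀ v ∈ C, r₁ v ≤ f (r₂ v)) :
    sInf ((fun C => sSup (r₂ '' C)) '' Γ) ≤ f (sInf ((fun C => sSup (r₁ '' C)) '' Γ)) := by
  have hnn : ∀ {r : X → ℝ}, (∀ C ∈ Γ, ∀ v ∈ C, 0 ≤ r v) →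
      ∀ s ∈ (fun C => sSup (r '' C)) '' Γ, 0 ≤ s := by
    rintro r hr _ ⟨C, hC, rfl⟩
    refine Real.sSup_nonneg ?_
    rintro _ ⟨v, hv, rfl⟩
    exact hr C hC v hv
  have hsup : ∀ C ∈ Γ, sSup (r₂ '' C) ≤ f (sSup (r₁ '' C)) := by
    intro C hC
    by_cases hb : BddAbove (r₁ '' C)
    · rcases C.eq_empty_or_nonempty with rfl | hne
      · simpa using hf0
      · refine csSup_le (hne.image _) ?_
        rintro _ ⟨v, hv, rfl⟩
        have hle := le_csSup hb (mem_image_of_mem r₁ hv)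
        exact (h₁₂ C hC v hv).trans
          (hf (h₁ C hC v hv) ((h₁ C hC v hv).trans hle) hle)
    · have hb₂ : ¬BddAbove (r₂ '' C) := by
        rintro ⟨b, hb₂⟩
        refine hb ⟨f b, ?_⟩
        rintro _ ⟨v, hv, rfl⟩
        have hle := hb₂ (mem_image_of_mem r₂ hv)
        exact (h₂₁ C hC v hv).trans (hf (h₂ C hC v hv) ((h₂ C hC v hv).trans hle) hle)
      rwa [Real.sSup_of_not_bddAbove hb, Real.sSup_of_not_bddAbove hb₂]
  rcases Γ.eq_empty_or_nonempty with rfl | hne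
  · simpa using hf0
  · obtain ⟨s, -, hs, hsΓ⟩ := exists_seq_tendsto_sInf (hne.image fun C => sSup (r₁ '' C))
      ⟨0, hnn h₁⟩
    refine ge_of_tendsto' ((hfc.tendsto _).comp hs) fun n => ?_
    obtain ⟨C, hC, hCs⟩ := hsΓ n
    rw [Function.comp_apply, ← hCs]
    exact (csInf_le ⟨0, hnn h₂⟩ (mem_image_of_mem _ hC)).trans (hsup C hC)

theorem integral_weight_mul_rpow_mem_Icc {X : Type*} [MeasurableSpace X] {μ : Measure X}
    {p : ℝ} (hp : 0 < p) {w : X → ℝ} (hwm : AEStronglyMeasurable w μ) {m M : ℝ} (hm : 0 < m)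
    (hw : ∀ᵐ x ∂μ, m ≤ w x ∧ w x ≤ M) (f : Lp ℝ (ENNReal.ofReal p) μ) :
    ∫ x, w x * |f x| ^ p ∂μ ∈ Icc (m * ‖f‖ ^ p) (M * ‖f‖ ^ p) := by
  have hf := integrable_norm_rpow_Lp hp f
  have hwf : Integrable (fun x => w x * |f x| ^ p) μ := by
    refine hf.bdd_mul hwm (c := M) ?_
    filter_upwards [hw] with x hx
    rw [Real.norm_of_nonneg (hm.le.trans hx.1)]
    exact hx.2
  rw [Lp_norm_rpow_eq_integral hp, ← integral_const_mul, ← integral_const_mul]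
  constructor
  · refine integral_mono_ae (hf.const_mul m) hwf ?_
    filter_upwards [hw] with x hx
    exact mul_le_mul_of_nonneg_right hx.1 (by positivity)
  · refine integral_mono_ae hwf (hf.const_mul M) ?_
    filter_upwards [hw] with x hx
    exact mul_le_mul_of_nonneg_right hx.2 (by positivity)

theorem variationalEigenvalue_le_add {N : ℕ} {p : ℝ} [hp : Fact (1 < p)]
    {Ω : Set (EuclideanSpace ℝ (Fin N))}
    {a : EuclideanSpace ℝ (Fin N) → EuclideanSpace ℝ (Fin N) → EuclideanSpace ℝ (Fin N)}
    {α β : ℝ} (hα : 0 < α) (ha : IsAdmissibleOperator p Ω α β a)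
    {w₁ w₂ : EuclideanSpace ℝ (Fin N) → ℝ}
    (hm₁ : AEStronglyMeasurable w₁ (volume.restrict Ω))
    (hm₂ : AEStronglyMeasurable w₂ (volume.restrict Ω)) {m M K : ℝ} (hm : 0 < m) (hM : 0 ≤ M)
    (h₁ : ∀ᵐ x ∂(volume.restrict Ω), m ≤ w₁ x ∧ w₁ x ≤ M)
    (h₂ : ∀ᵐ x ∂(volume.restrict Ω), m ≤ w₂ x ∧ w₂ x ≤ M) (hK : 0 ≤ K)
    (hφ : ∀ φ, IsTestFunction Ω φ → |∫ x in Ω, (w₁ x - w₂ x) * |φ x| ^ p| ≤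
      K * ∫ x in Ω, |φ x| ^ (p - 1) * ‖gradient φ x‖) (k : ℕ) :
    variationalEigenvalue p Ω a w₂ k ≤ variationalEigenvalue p Ω a w₁ k +
      K * (M / α) ^ (1 / p) * (1 / m) * (variationalEigenvalue p Ω a w₁ k) ^ (1 + 1 / p) := by
  have hp0 : 0 < p := zero_lt_one.trans hp.out
  have hA := fun v : SobolevPair p Ω => ha.mul_norm_rpow_le_energy hp.out v.2
  have hB₁ := fun v : SobolevPair p Ω => integral_weight_mul_rpow_mem_Icc hp0 hm₁ hm h₁ v.1
  have hB₂ := fun v : SobolevPair p Ω => integral_weight_mul_rpow_mem_Icc hp0 hm₂ hm h₂ v.1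
  have hdiff : ∀ v ∈ sobolevZero p Ω, _ := fun v hv =>
    abs_weight_sub_le_of_mem_sobolevZero hm₁ hm₂ (h₁.mono fun x hx => ⟨hm.le.trans hx.1, hx.2⟩)
      (h₂.mono fun x hx => ⟨hm.le.trans hx.1, hx.2⟩) hK hφ hv
  refine sInf_sSup_le_of_le
    (f := fun s => s + K * (M / α) ^ (1 / p) * (1 / m) * s ^ (1 + 1 / p)) ?_ ?_ ?_ ?_ ?_ ?_ ?_
  · intro s hs t _ hst
    have hs' : 0 ≤ s := hs
    dsimp only
    gcongr
  · have : 0 ≤ 1 + 1 / p := by positivity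
    exact continuous_id.add (continuous_const.mul (continuous_id.rpow_const fun _ => .inr this))
  · positivity
  · intro C _ v _
    exact div_nonneg ((by positivity : 0 ≤ α * ‖v.2‖ ^ p).trans (hA v))
      ((by positivity : 0 ≤ m * ‖v.1‖ ^ p).trans (hB₁ v).1)
  · intro C _ v _
    exact div_nonneg ((by positivity : 0 ≤ α * ‖v.2‖ ^ p).trans (hA v))
      ((by positivity : 0 ≤ m * ‖v.1‖ ^ p).trans (hB₂ v).1)
  · intro C hC v hv
    exact quotient_le_add_rpow hp.out hα (norm_nonneg v.1) (norm_nonneg v.2) hK hm hM (hA v)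
      (hB₁ v).1 (hB₁ v).2 (hB₂ v).1 (hB₂ v).2 (hdiff v (hC.1 hv))
  · intro C hC v hv
    exact quotient_le_add_rpow hp.out hα (norm_nonneg v.1) (norm_nonneg v.2) hK hm hM (hA v)
      (hB₂ v).1 (hB₂ v).2 (hB₁ v).1 (hB₁ v).2 (by rw [abs_sub_comm]; exact hdiff v (hC.1 hv))

theorem variationalEigenvalue_nonneg {N : ℕ} {p : ℝ} [hp : Fact (1 < p)]
    {Ω : Set (EuclideanSpace ℝ (Fin N))}
    {a : EuclideanSpace ℝ (Fin N) → EuclideanSpace ℝ (Fin N) → EuclideanSpace ℝ (Fin N)}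
    {α β : ℝ} (hα : 0 < α) (ha : IsAdmissibleOperator p Ω α β a)
    {w : EuclideanSpace ℝ (Fin N) → ℝ} (hw : ∀ᵐ x ∂(volume.restrict Ω), 0 ≤ w x) (k : ℕ) :
    0 ≤ variationalEigenvalue p Ω a w k := by
  refine Real.sInf_nonneg ?_
  rintro _ ⟨C, -, rfl⟩
  refine Real.sSup_nonneg ?_
  rintro _ ⟨v, -, rfl⟩
  refine div_nonneg ((by positivity : 0 ≤ α * ‖v.2‖ ^ p).trans
    (ha.mul_norm_rpow_le_energy hp.out v.2)) (integral_nonneg_of_ae ?_)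
  filter_upwards [hw] with x hx
  exact mul_nonneg hx (by positivity)

/-! ### The eigenvalue estimate -/

/-- The bound `C` only serves to make the essential supremum finite, so that `toReal` does not send
it to `0`. -/
theorem ae_abs_le_toReal_eLpNorm_top {X : Type*} [MeasurableSpace X] {μ : Measure X} {w : X → ℝ}
    {C : ℝ} (hw : ∀ᵐ x ∂μ, |w x| ≤ C) : ∀ᵐ x ∂μ, |w x| ≤ (eLpNorm w ⊤ μ).toReal := by
  have hfin : eLpNorm w ⊤ μ ≠ ⊤ := (eLpNorm_le_of_ae_bound (p := ⊤) hw).trans_lt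
    (by simp) |>.ne
  filter_upwards [ae_le_eLpNormEssSup (f := w) (μ := μ)] with x hx
  rw [← eLpNorm_exponent_top] at hx
  have := ENNReal.toReal_mono hfin hx
  simpa using this

theorem mainTheorem2 (N : ℕ) (hN : 1 ≤ N) (p : ℝ) [Fact (1 < p)]
    (Ω : Set (EuclideanSpace ℝ (Fin N))) (hΩ : IsOpen Ω) (hΩne : Ω.Nonempty)
    (hΩb : Bornology.IsBounded Ω)
    (a : EuclideanSpace ℝ (Fin N) → EuclideanSpace ℝ (Fin N) → EuclideanSpace ℝ (Fin N))
    (α β : ℝ) (hα : 0 < α) (ha : IsAdmissibleOperator p Ω α β a)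
    (ρ : EuclideanSpace ℝ (Fin N) → ℝ) (hρm : AEMeasurable ρ volume)
    (hρper : ∀ i, ∀ᵐ x, ρ (x + EuclideanSpace.single i 1) = ρ x)
    (ρlow ρup : ℝ) (hρlow : 0 < ρlow) (hρ : ∀ᵐ x, ρlow ≤ ρ x ∧ ρ x ≤ ρup)
    (ρbar : ℝ) (hρbar : ρbar = ∫ x in unitCube N, ρ x)
    (ε : ℝ) (hε : 0 < ε) (k : ℕ) (hk : 1 ≤ k)
    (lam lamε : ℝ)
    (hlam : lam = variationalEigenvalue p Ω a (fun _ => ρbar) k)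
    (hlamε : lamε = variationalEigenvalue p Ω a (fun x => ρ (ε⁻¹ • x)) k) :
    |lamε - lam| ≤
      poincareConstant N * p * (eLpNorm (fun x => ρ x - ρbar) ∞ volume).toReal *
        (ρup / α) ^ (1 / p) * (1 / ρlow) * ε * (max lam lamε) ^ (1 + 1 / p) := by
  have hp : 1 < p := Fact.out
  have hp0 : 0 < p := zero_lt_one.trans hp
  have hρi : IntegrableOn ρ (unitCube N) := by
    refine .of_bound (by rw [volume_unitCube]; simp) hρm.aestronglyMeasurable.restrict ρup ?_
    filter_upwards [ae_restrict_of_ae hρ] with x hx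
    rw [Real.norm_of_nonneg (hρlow.le.trans hx.1)]
    exact hx.2
  have hbar : ρlow ≤ ρbar ∧ ρbar ≤ ρup := by
    have hconst : ∀ c : ℝ, ∫ _x in unitCube N, c = c := fun c => by simp
    rw [hρbar, ← hconst ρlow, ← hconst ρup]
    constructor
    · exact integral_mono_ae (integrable_const _) hρi
        ((ae_restrict_of_ae hρ).mono fun x hx => hx.1)
    · exact integral_mono_ae hρi (integrable_const _)
        ((ae_restrict_of_ae hρ).mono fun x hx => hx.2)
  have hup : 0 ≤ ρup := hρlow.le.trans (hbar.1.trans hbar.2)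
  set M := (eLpNorm (fun x => ρ x - ρbar) ∞ volume).toReal
  have hM : ∀ᵐ x, |ρ x - ρbar| ≤ M := by
    -- Both `ρ` and its mean lie between `ρlow > 0` and `ρup`, so they differ by at most `ρup`.
    refine ae_abs_le_toReal_eLpNorm_top (C := ρup) ?_
    filter_upwards [hρ] with x hx
    rw [abs_le]
    constructor <;> linarith [hx.1, hx.2, hbar.1, hbar.2]
  have hqmp := Measure.quasiMeasurePreserving_smul
    (volume : Measure (EuclideanSpace ℝ (Fin N))) (inv_ne_zero hε.ne')
  have hρε : ∀ᵐ x ∂(volume.restrict Ω), ρlow ≤ ρ (ε⁻¹ • x) ∧ ρ (ε⁻¹ • x) ≤ ρup :=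
    ae_restrict_of_ae (hqmp.ae hρ)
  have hρεm : AEStronglyMeasurable (fun x => ρ (ε⁻¹ • x)) (volume.restrict Ω) :=
    (hρm.comp_quasiMeasurePreserving hqmp).aestronglyMeasurable.restrict
  have hK : 0 ≤ poincareConstant N * p * M * ε := by
    have := poincareConstant_nonneg N
    have : 0 ≤ M := ENNReal.toReal_nonneg
    positivity
  have hφ : ∀ φ, IsTestFunction Ω φ → |∫ x in Ω, (ρ (ε⁻¹ • x) - ρbar) * |φ x| ^ p| ≤
      poincareConstant N * p * M * ε * ∫ x in Ω, |φ x| ^ (p - 1) * ‖gradient φ x‖ := by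
    intro φ hφ
    have h0 : ∀ x ∉ Ω, φ x = 0 := fun x hx =>
      image_eq_zero_of_notMem_tsupport fun h => hx (hφ.2.2 h)
    rw [setIntegral_eq_integral_of_forall_compl_eq_zero fun x hx => by
        rw [h0 x hx, abs_zero, Real.zero_rpow hp0.ne', mul_zero],
      setIntegral_eq_integral_of_forall_compl_eq_zero fun x hx => by
        rw [h0 x hx, abs_zero, Real.zero_rpow (sub_pos.2 hp).ne', zero_mul]]
    refine abs_integral_oscillating_mul_rpow_le (w := fun x => ρ x - ρbar)
      (hρm.sub_const ρbar).aestronglyMeasurable hM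
      (fun i => (hρper i).mono fun x hx => by rw [hx]) ?_ hp hε
      (hφ.1.of_le (by exact_mod_cast le_top)) hφ.2.1
    rw [integral_sub hρi (integrable_const _), ← hρbar]
    simp
  have hφ' : ∀ φ, IsTestFunction Ω φ → |∫ x in Ω, (ρbar - ρ (ε⁻¹ • x)) * |φ x| ^ p| ≤
      poincareConstant N * p * M * ε * ∫ x in Ω, |φ x| ^ (p - 1) * ‖gradient φ x‖ := by
    intro φ h
    refine le_of_eq_of_le ?_ (hφ φ h)
    rw [← abs_neg, ← integral_neg]
    simp only [← neg_mul, neg_sub]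
  -- The comparison is one-sided, so it is used twice with the weights exchanged; the maximum in the
  -- conclusion covers both cases.
  have key₁ := variationalEigenvalue_le_add hα ha hρεm aestronglyMeasurable_const hρlow hup hρε
    (.of_forall fun _ => hbar) hK hφ k
  have key₂ := variationalEigenvalue_le_add hα ha aestronglyMeasurable_const hρεm hρlow hup
    (.of_forall fun _ => hbar) hρε hK hφ' k
  have hn := variationalEigenvalue_nonneg hα ha (w := fun _ => ρbar)
    (.of_forall fun _ => hρlow.le.trans hbar.1) k
  have hnε := variationalEigenvalue_nonneg hα ha (w := fun x => ρ (ε⁻¹ • x))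
    (hρε.mono fun x hx => hρlow.le.trans hx.1) k
  rw [← hlam] at key₁ key₂ hn
  rw [← hlamε] at key₁ key₂ hnε
  set K := poincareConstant N * p * M * ε * (ρup / α) ^ (1 / p) * (1 / ρlow) with hKdef
  have hK' : 0 ≤ K := by positivity
  have hmono : ∀ {s : ℝ}, 0 ≤ s → s ≤ max lam lamε →
      K * s ^ (1 + 1 / p) ≤ K * max lam lamε ^ (1 + 1 / p) := fun hs hsm =>
    mul_le_mul_of_nonneg_left (Real.rpow_le_rpow hs hsm (by positivity)) hK'
  have h1 := hmono hn (le_max_left _ _)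
  have h2 := hmono hnε (le_max_right _ _)
  have hgoal : poincareConstant N * p * M * (ρup / α) ^ (1 / p) * (1 / ρlow) * ε *
      max lam lamε ^ (1 + 1 / p) = K * max lam lamε ^ (1 + 1 / p) := by
    rw [hKdef]
    ring
  rw [hgoal, abs_le]
  constructor <;> linarith
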